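/- Let $\mathbb{K}$ be a field of characteristic zero, $V$ a finite-dimensional $\mathbb{K}$-vector space of dimension $r\ge 1$, and $U=V^*$ its dual. Let $X=(x_1,\ldots,x_N)$ be a finite sequence of vectors of $U$ whose elements span $U$ (zero vectors and repetitions are allowed). Subsequences $Y\subseteq X$ are identified with subsets of the index set $\{1,\ldots,N\}$; such a $Y$ is independent if the family $(x_i)_{i\in Y}$ is linearly independent, and this defines a matroid on $\{1,\ldots,N\}$. Let $\operatorname{clos}$ denote its closure operator and $\mathcal{L}(X)$ its lattice of flats (ordered by inclusion), and let $J\subseteq\mathcal{L}(X)$ be a non-empty upper set, i.e. $C\in J$, $C'\in\mathcal{L}(X)$ and $C\subseteq C'$ imply $C'\in J$. For $x\in U$ let $p_x$ be the image of $x$ in the symmetric algebra $\operatorname{Sym}(U)$, for $Y\subseteq X$ put $p_Y:=\prod_{i\in Y}p_{x_i}$, and define $$\mathcal{P}(X,0,J):=\operatorname{span}_{\mathbb{K}}\{\,p_Y : Y\subseteq X,\ \operatorname{clos}(X\setminus Y)\in J\,\}\subseteq \operatorname{Sym}(U).$$ Then $$\dim_{\mathbb{K}} \mathcal{P}(X,0,J)=\bigl|\{\,Y\subseteq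 X : Y\text{ independent},\ \operatorname{clos}(Y)\in J\,\}\bigr| .$$ -/

import Mathlib

namespace Zonotopal

variable {K U : Type*} [Field K] [AddCommGroup U] [Module K U] {N : ℕ}

/-- The matroid on the index set of a finite sequence of vectors `X`: a set of indices `I` is
independent iff the subfamily `(X i : i ∈ I)` is linearly independent over `K`. -/
noncomputable def vectorMatroid (K : Type*) {U : Type*} [Field K] [AddCommGroup U] [Module K U]
    {N : ℕ} (X : Fin N → U) : Matroid (Fin N) :=
  (IndepMatroid.ofFinite (E := Set.univ) Set.finite_univ
    (Indep := fun I => LinearIndepOn K X I)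
    (indep_empty := linearIndepOn_empty K X)
    (indep_subset := fun _ _ hJ hIJ => LinearIndepOn.mono hJ hIJ)
    (indep_aug := by
      intro I J hI hJ hlt
      by_contra! hcon
      have hsub : X '' J ⊆ Submodule.span K (X '' I) := by
        rintro _ ⟨e, he, rfl⟩
        by_cases heI : e ∈ I
        · exact Submodule.subset_span ⟨e, heI, rfl⟩
        · by_contra hns
          exact hcon e he heI (hI.insert hns)
      have hle : Submodule.span K (X '' J) ≤ Submodule.span K (X '' I) :=
        Submodule.span_le.2 hsub
      have : FiniteDimensional K (Submodule.span K (X '' I)) :=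
        FiniteDimensional.span_of_finite K ((Set.toFinite I).image X)
      have h := Submodule.finrank_mono hle
      have card_eq : ∀ S : Set (Fin N), LinearIndepOn K X S →
          Module.finrank K (Submodule.span K (X '' S)) = S.ncard := by
        intro S hS
        classical
        have h1 := finrank_span_eq_card (R := K) (b := fun i : S => X i) hS
        rw [Set.image_eq_range, h1, ← Nat.card_eq_fintype_card, Nat.card_coe_set_eq]
      rw [card_eq I hI, card_eq J hJ] at h
      omega)
    (subset_ground := fun _ _ => Set.subset_univ _)).matroid

/-- The lattice of flats of the matroid defined by `X`, ordered by inclusion. -/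
abbrev Flats (K : Type*) {U : Type*} [Field K] [AddCommGroup U] [Module K U]
    {N : ℕ} (X : Fin N → U) : Type :=
  {C : Set (Fin N) // (vectorMatroid K X).IsFlat C}

/-- The closure of a subsequence of `X` (given by its set of indices) in the matroid of `X`,
as an element of the lattice of flats. -/
noncomputable def clos (K : Type*) {U : Type*} [Field K] [AddCommGroup U] [Module K U]
    {N : ℕ} (X : Fin N → U) (Y : Set (Fin N)) : Flats K X :=
  ⟨(vectorMatroid K X).closure Y, (vectorMatroid K X).isFlat_closure Y⟩

/-- The product `p_Y = ∏_{x ∈ Y} p_x` in the symmetric algebra `Sym(U)`, where `p_x` is the image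
of `x` under the canonical injection of `U` into `Sym(U)`. -/
noncomputable def p (K : Type*) {U : Type*} [Field K] [AddCommGroup U] [Module K U]
    {N : ℕ} (X : Fin N → U) (Y : Finset (Fin N)) : SymmetricAlgebra K U :=
  ∏ i ∈ Y, SymmetricAlgebra.ι K U (X i)

/-- The generating set `S(X, 0, J) = {p_Y : Y ⊆ X, clos (X \ Y) ∈ J}`. -/
def S0 (X : Fin N → U) (J : Set (Flats K X)) : Set (SymmetricAlgebra K U) :=
  {f | ∃ Y : Finset (Fin N), clos K X (Set.univ \ (Y : Set (Fin N))) ∈ J ∧ p K X Y = f}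

/-- The space `P(X, 0, J)`, the linear span of `S(X, 0, J)` in `Sym(U)`. -/
def P0 (X : Fin N → U) (J : Set (Flats K X)) : Submodule K (SymmetricAlgebra K U) :=
  Submodule.span K (S0 X J)

end Zonotopal

namespace Zonotopal

open Submodule Finset

/-! ### External passivity and linear independence of the passive products. -/

section Activity

variable {ι : Type*} [LinearOrder ι]

/-! Order the indices and attach to each independent `I` the product of its externally passive
elements. The products with `clos I ∈ J` form a basis of the space. Independence
(`passiveProd_coeff_eq_zero`) is deletion-contraction at the largest index `a`, with `X a ≠ 0`: if
`a ∉ I` the product is divisible by `p_a`, and if `a ∈ I` its image modulo `p_a` is the product for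
the contraction. Spanning (`p_compl_mem_span_passiveProd`) straightens `p_{Tᶜ}` by exchanges that
preserve the span of `T`, hence its closure. Conversely, by `span_compl_passive`, each such product
is itself a generator. -/

open scoped Classical in
/-- The elements of `S` that are externally passive with respect to `I`: those `i ∈ S \ I` such that
`X i` is not spanned by the vectors of `I` with larger index. -/
noncomputable def passive (K : Type*) {U : Type*} [Field K] [AddCommGroup U] [Module K U]
    (X : ι → U) (S I : Finset ι) : Finset ι :=
  S.filter fun i => i ∉ I ∧ X i ∉ span K (X '' {j | j ∈ I ∧ i < j})

/-- The product of the externally passive elements of `S` with respect to `I`. -/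
noncomputable def passiveProd (K : Type*) {U : Type*} [Field K] [AddCommGroup U] [Module K U]
    (X : ι → U) (S I : Finset ι) : SymmetricAlgebra K U :=
  ∏ i ∈ passive K X S I, SymmetricAlgebra.ι K U (X i)

open scoped Classical in
/-- The greedy basis of `T`, built by scanning `T` downwards. -/
noncomputable def greedyBasis (K : Type*) {U : Type*} [Field K] [AddCommGroup U] [Module K U]
    (X : ι → U) (T : Finset ι) : Finset ι :=
  T.filter fun i => X i ∉ span K (X '' {j | j ∈ T ∧ i < j})

theorem ι_ne_zero {K U : Type*} [Field K] [AddCommGroup U] [Module K U] {x : U} (hx : x ≠ 0) :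
    SymmetricAlgebra.ι K U x ≠ 0 := by
  obtain ⟨f, hf⟩ := Module.Projective.exists_dual_ne_zero K hx
  intro h
  rw [← SymmetricAlgebra.lift_ι_apply f x, h, map_zero] at hf
  exact hf rfl

theorem mem_span_image_mono {ι K U : Type*} [Field K] [AddCommGroup U] [Module K U] {X : ι → U}
    {s t : Set ι} {y : U} (hy : y ∈ span K (X '' s)) (hst : s ⊆ t) : y ∈ span K (X '' t) :=
  span_mono (Set.image_mono hst) hy

section

variable {K U : Type*} [Field K] [AddCommGroup U] [Module K U] {X : ι → U} {S I : Finset ι} {a : ι}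

theorem mem_passive {i : ι} :
    i ∈ passive K X S I ↔ i ∈ S ∧ i ∉ I ∧ X i ∉ span K (X '' {j | j ∈ I ∧ i < j}) := by
  classical
  exact mem_filter

theorem mem_greedyBasis {T : Finset ι} {i : ι} :
    i ∈ greedyBasis K X T ↔ i ∈ T ∧ X i ∉ span K (X '' {j | j ∈ T ∧ i < j}) := by
  classical
  exact mem_filter

theorem passive_insert_of_eq_zero (ha : X a = 0) :
    passive K X (insert a S) I = passive K X S I := by
  classical
  rw [passive, filter_insert, if_neg (by simp [ha]), passive]

theorem passive_insert_of_forall_lt (haS : ∀ i ∈ S, i < a) (hI : I ⊆ S) (ha : X a ≠ 0) :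
    passive K X (insert a S) I = insert a (passive K X S I) := by
  classical
  have hset : {j | j ∈ I ∧ a < j} = (∅ : Set ι) := by
    ext j
    simpa using fun hj => (haS j (hI hj)).le
  have haI : a ∉ I := fun h => lt_irrefl _ (haS a (hI h))
  rw [passive, filter_insert, if_pos (by simp [hset, ha, haI]), passive]

theorem passiveProd_insert_of_forall_lt (haS : ∀ i ∈ S, i < a) (hI : I ⊆ S) (ha : X a ≠ 0) :
    passiveProd K X (insert a S) I = SymmetricAlgebra.ι K U (X a) * passiveProd K X S I := by
  classical
  rw [passiveProd, passive_insert_of_forall_lt haS hI ha, prod_insert, passiveProd]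
  exact fun h => lt_irrefl _ (haS a (mem_passive.1 h).1)

theorem mkQ_mem_span_image_iff {x : U} {s : Set U} {y : U} :
    (span K {x}).mkQ y ∈ span K ((span K {x}).mkQ '' s) ↔ y ∈ span K (insert x s) := by
  rw [← map_span, ← mem_comap, comap_map_mkQ, ← span_union, Set.singleton_union]

/-- As `a` exceeds every index of `S`, `X a` lies in each span tested, so membership can be checked
modulo `X a`. -/
theorem passive_insert_insert (haS : ∀ i ∈ S, i < a) (hI : I ⊆ S) :
    passive K X (insert a S) (insert a I) =
      passive K (fun i => (span K {X a}).mkQ (X i)) S I := by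
  classical
  rw [passive, filter_insert, if_neg (by simp), passive]
  refine filter_congr fun i hi => ?_
  have hia := haS i hi
  have hset : {j | j ∈ insert a I ∧ i < j} = insert a {j | j ∈ I ∧ i < j} := by
    ext j
    simp only [mem_insert, Set.mem_ofPred_eq, Set.mem_insert_iff]
    grind
  rw [hset, Set.image_insert_eq, ← mkQ_mem_span_image_iff, Set.image_image]
  simp [hia.ne]

theorem map_passiveProd_insert_insert (haS : ∀ i ∈ S, i < a) (hI : I ⊆ S) :
    SymmetricAlgebra.lift (SymmetricAlgebra.ι K _ ∘ₗ (span K {X a}).mkQ)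
        (passiveProd K X (insert a S) (insert a I)) =
      passiveProd K (fun i => (span K {X a}).mkQ (X i)) S I := by
  rw [passiveProd, passive_insert_insert haS hI, map_prod]
  simp [passiveProd, SymmetricAlgebra.lift_ι_apply]

end

/-- The products of externally passive elements, indexed by independent sets, are linearly
independent. -/
theorem passiveProd_coeff_eq_zero {K : Type*} [Field K] (S : Finset ι) {U : Type*} [AddCommGroup U]
    [Module K U] (X : ι → U) (c : Finset ι → K)
    (hc : ∀ I ⊆ S, ¬ LinearIndepOn K X (I : Set ι) → c I = 0)
    (hsum : ∑ I ∈ S.powerset, c I • passiveProd K X S I = 0) : ∀ I ⊆ S, c I = 0 := by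
  induction S using Finset.induction_on_max generalizing U c with
  | empty =>
    intro I hI
    obtain rfl := subset_empty.1 hI
    simpa [passiveProd, passive] using hsum
  | insert a S haS ih =>
    have haS' : a ∉ S := fun h => lt_irrefl _ (haS a h)
    rw [sum_powerset_insert haS'] at hsum
    have key : (∀ I ⊆ S, c (insert a I) = 0) → (∀ I ⊆ S, c I = 0) →
        ∀ I ⊆ insert a S, c I = 0 := by
      intro h1 h2 I hI
      by_cases haI : a ∈ I
      · rw [← insert_erase haI]
        exact h1 _ (by rwa [← subset_insert_iff])
      · exact h2 _ ((subset_insert_iff_of_notMem haI).1 hI)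
    have hcS : ∀ I ⊆ S, ¬ LinearIndepOn K X (I : Set ι) → c I = 0 :=
      fun I hI => hc I (hI.trans (subset_insert _ _))
    by_cases ha : X a = 0
    · have h1 : ∀ I ⊆ S, c (insert a I) = 0 := fun I hI =>
        hc _ (insert_subset_insert _ hI) fun h => h.ne_zero (i := a) (by simp) ha
      refine key h1 (ih X c hcS ?_)
      rw [sum_eq_zero (s := S.powerset) (f := fun I => c (insert a I) • _)
        fun I hI => by rw [h1 I (mem_powerset.1 hI), zero_smul], add_zero] at hsum
      simpa only [passiveProd, passive_insert_of_eq_zero ha] using hsum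
    · have hmul : ∑ I ∈ S.powerset, c I • passiveProd K X (insert a S) I =
          SymmetricAlgebra.ι K U (X a) * ∑ I ∈ S.powerset, c I • passiveProd K X S I := by
        rw [mul_sum]
        refine sum_congr rfl fun I hI => ?_
        rw [passiveProd_insert_of_forall_lt haS (mem_powerset.1 hI) ha, mul_smul_comm]
      rw [hmul] at hsum
      have h1 : ∀ I ⊆ S, c (insert a I) = 0 := by
        refine ih (fun i => (span K {X a}).mkQ (X i)) (fun I => c (insert a I)) ?_ ?_
        · intro I hI hdep
          refine hc _ (insert_subset_insert _ hI) fun h => hdep ?_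
          rw [coe_insert, ← Set.singleton_union] at h
          have h1 : LinearIndepOn K X {a} := by simpa using ha
          have := (h1.quotient_iff_union (t := (I : Set ι)) (by
            simpa using fun h => haS' (hI h))).2 h
          rwa [Set.image_singleton] at this
        -- Passing to the symmetric algebra of the quotient kills the multiple of `p_a` and leaves
        -- the relation for the contraction.
        · have := congrArg
            (SymmetricAlgebra.lift (SymmetricAlgebra.ι K _ ∘ₗ (span K {X a}).mkQ)) hsum
          rw [map_add, map_mul, SymmetricAlgebra.lift_ι_apply, LinearMap.comp_apply,
            mkQ_apply, (Quotient.mk_eq_zero _).2 (mem_span_singleton_self _), map_zero, zero_mul, zero_add,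
            map_sum, map_zero] at this
          rw [← this]
          refine sum_congr rfl fun I hI => ?_
          rw [map_smul, map_passiveProd_insert_insert haS (mem_powerset.1 hI)]
      rw [sum_eq_zero (s := S.powerset) (f := fun I => c (insert a I) • _)
        fun I hI => by rw [h1 I (mem_powerset.1 hI), zero_smul], add_zero] at hsum
      -- The symmetric algebra is a domain, so `p_a` cancels, leaving the relation for the deletion.
      exact key h1 (ih X c hcS ((mul_eq_zero.1 hsum).resolve_left (ι_ne_zero ha)))

theorem linearIndepOn_passiveProd {K U : Type*} [Field K] [AddCommGroup U] [Module K U] [Fintype ι]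
    (X : ι → U) :
    LinearIndepOn K (passiveProd K X univ) {I : Finset ι | LinearIndepOn K X (I : Set ι)} := by
  classical
  rw [linearIndepOn_iff]
  intro l hl h0
  ext I
  refine passiveProd_coeff_eq_zero univ X l ?_ ?_ I (subset_univ _)
  · intro I _ hI
    by_contra hne
    exact hI (hl (by simpa using hne))
  · rw [← h0, Finsupp.linearCombination_apply, Finsupp.sum_fintype _ _ (by simp), powerset_univ]

/-! ### Greedy bases and exchange. -/

section Greedy

variable {K U : Type*} [Field K] [AddCommGroup U] [Module K U] {X : ι → U} {T : Finset ι}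

theorem linearIndepOn_of_notMem_span_gt (I : Finset ι)
    (h : ∀ i ∈ I, X i ∉ span K (X '' {j | j ∈ I ∧ i < j})) : LinearIndepOn K X (I : Set ι) := by
  induction I using Finset.induction_on_min with
  | empty => simp
  | insert a s has ih =>
    rw [coe_insert]
    refine (ih fun i hi hmem => h i (mem_insert_of_mem hi) ?_).insert
      fun hmem => h a (mem_insert_self _ _) ?_
    · exact mem_span_image_mono hmem fun j hj => ⟨mem_insert_of_mem hj.1, hj.2⟩
    · exact mem_span_image_mono hmem fun j hj => ⟨mem_insert_of_mem hj, has j hj⟩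

theorem greedyBasis_subset : greedyBasis K X T ⊆ T := fun _ hi => (mem_greedyBasis.1 hi).1

theorem linearIndepOn_greedyBasis : LinearIndepOn K X (greedyBasis K X T : Set ι) :=
  linearIndepOn_of_notMem_span_gt _ fun _ hi hmem => (mem_greedyBasis.1 hi).2 <|
    mem_span_image_mono hmem fun _ hj => ⟨greedyBasis_subset hj.1, hj.2⟩

theorem mem_span_greedyBasis_ge [WellFoundedGT ι] (i : ι) (hi : i ∈ T) :
    X i ∈ span K (X '' {j | j ∈ greedyBasis K X T ∧ i ≤ j}) := by
  induction i using WellFoundedGT.induction with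
  | ind i ih =>
    by_cases hg : i ∈ greedyBasis K X T
    · exact subset_span ⟨i, ⟨hg, le_rfl⟩, rfl⟩
    · have hmem : X i ∈ span K (X '' {j | j ∈ T ∧ i < j}) := by
        by_contra hcon
        exact hg (mem_greedyBasis.2 ⟨hi, hcon⟩)
      refine span_le.2 ?_ hmem
      rintro _ ⟨j, ⟨hj, hij⟩, rfl⟩
      exact mem_span_image_mono (ih j hij hj) fun k hk => ⟨hk.1, hij.le.trans hk.2⟩

theorem span_greedyBasis_gt [WellFoundedGT ι] (i : ι) :
    span K (X '' {j | j ∈ greedyBasis K X T ∧ i < j}) = span K (X '' {j | j ∈ T ∧ i < j}) := by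
  refine le_antisymm (span_mono (Set.image_mono fun j hj => ⟨greedyBasis_subset hj.1, hj.2⟩)) ?_
  rw [span_le]
  rintro _ ⟨j, ⟨hj, hij⟩, rfl⟩
  exact mem_span_image_mono (mem_span_greedyBasis_ge j hj) fun k hk => ⟨hk.1, hij.trans_le hk.2⟩

theorem span_greedyBasis [WellFoundedGT ι] :
    span K (X '' (greedyBasis K X T : Set ι)) = span K (X '' (T : Set ι)) := by
  refine le_antisymm (span_mono (Set.image_mono (coe_subset.2 greedyBasis_subset))) ?_
  rw [span_le]
  rintro _ ⟨j, hj, rfl⟩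
  exact mem_span_image_mono (mem_span_greedyBasis_ge j hj) fun k hk => hk.1

/-- The terminal case of straightening: above every index the greedy basis and `T` have the same
span, so passivity may be tested against `T`. -/
theorem passive_greedyBasis [Fintype ι]
    (hT : ∀ i ∉ T, X i ∉ span K (X '' {j | j ∈ T ∧ i < j})) :
    passive K X univ (greedyBasis K X T) = Tᶜ := by
  classical
  ext i
  simp only [mem_passive, mem_univ, true_and, mem_compl, span_greedyBasis_gt]
  constructor
  · rintro ⟨h1, h2⟩ hi
    exact h1 (mem_greedyBasis.2 ⟨hi, h2⟩)
  · exact fun hi => ⟨fun h => hi (greedyBasis_subset h), hT i hi⟩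

end Greedy

/-- The coefficient of `z` is nonzero, so the relation can be solved for `X z`. -/
theorem span_image_exchange {K U : Type*} [Field K] [AddCommGroup U] [Module K U] {X : ι → U}
    {T : Finset ι} {l : ι →₀ K} {x z : ι} (hl : ∀ i ∈ l.support, i ∈ T) (hz : z ∈ l.support)
    (hx : Finsupp.linearCombination K X l = X x) :
    span K (X '' (insert x (T.erase z) : Finset ι)) = span K (X '' (T : Set ι)) := by
  rw [Finsupp.linearCombination_apply, Finsupp.sum] at hx
  refine le_antisymm (span_le.2 ?_) (span_le.2 ?_)
  · rintro _ ⟨i, hi, rfl⟩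
    rcases mem_insert.1 hi with rfl | hi
    · rw [← hx]
      exact sum_mem fun j hj => smul_mem _ _ (subset_span ⟨j, hl j hj, rfl⟩)
    · exact subset_span ⟨i, mem_of_mem_erase hi, rfl⟩
  · rintro _ ⟨i, hi, rfl⟩
    by_cases hiz : i = z
    · subst hiz
      rw [← add_sum_erase _ _ hz] at hx
      refine (smul_mem_iff _ (Finsupp.mem_support_iff.1 hz)).1 ?_
      rw [eq_sub_of_add_eq hx]
      refine sub_mem (subset_span ⟨x, by simp, rfl⟩) (sum_mem fun j hj => smul_mem _ _ ?_)
      have := mem_erase.1 hj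
      exact subset_span ⟨j, by simp [this.1, hl j this.2], rfl⟩
    · exact subset_span ⟨i, mem_insert_of_mem (mem_erase.2 ⟨hiz, hi⟩), rfl⟩

end Activity

/-! ### Straightening, closure and the dimension count. -/

section Main

variable {K U : Type*} [Field K] [AddCommGroup U] [Module K U] {N : ℕ} {X : Fin N → U}

theorem p_compl_mem_span_passiveProd (T : Finset (Fin N)) :
    p K X Tᶜ ∈ span K (passiveProd K X univ '' {I : Finset (Fin N) |
      LinearIndepOn K X (I : Set (Fin N)) ∧
        span K (X '' (I : Set (Fin N))) = span K (X '' (T : Set (Fin N)))}) := by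
  induction hn : ∑ i ∈ T, (i : ℕ) using Nat.strong_induction_on generalizing T with
  | _ n ih =>
    by_cases hT : ∀ i ∉ T, X i ∉ span K (X '' {j | j ∈ T ∧ i < j})
    · refine subset_span ⟨greedyBasis K X T, ⟨linearIndepOn_greedyBasis, span_greedyBasis⟩, ?_⟩
      rw [passiveProd, passive_greedyBasis hT, p]
    · push Not at hT
      obtain ⟨x, hxT, hx⟩ := hT
      obtain ⟨l, hl, hlx⟩ := (Finsupp.mem_span_image_iff_linearCombination K).1 hx
      have hl' : ∀ i ∈ l.support, i ∈ T ∧ x < i := fun i hi => hl hi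
      -- Expanding the factor `p_x` trades `x` for some `z > x` in the product, so `T` loses `z` and
      -- gains `x`; its index sum drops.
      have hp : p K X Tᶜ = ∑ z ∈ l.support, l z • p K X (insert x (T.erase z))ᶜ := by
        rw [p, ← mul_prod_erase _ _ (mem_compl.2 hxT), ← hlx, Finsupp.linearCombination_apply,
          Finsupp.sum, map_sum, sum_mul]
        refine sum_congr rfl fun z hz => ?_
        obtain ⟨hzT, hxz⟩ := hl' z hz
        have : (insert x (T.erase z))ᶜ = insert z (Tᶜ.erase x) := by
          ext i
          simp only [mem_compl, mem_insert, mem_erase]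
          grind
        rw [this, p, prod_insert (by simp [hzT]), map_smul, smul_mul_assoc]
      rw [hp]
      refine sum_mem fun z hz => smul_mem _ _ ?_
      obtain ⟨hzT, hxz⟩ := hl' z hz
      have hlt : ∑ i ∈ insert x (T.erase z), (i : ℕ) < n := by
        rw [← hn, sum_insert (by simp [hxT]), ← add_sum_erase _ _ hzT]
        exact Nat.add_lt_add_right hxz _
      have := ih _ hlt (insert x (T.erase z)) rfl
      rwa [span_image_exchange (fun i hi => (hl' i hi).1) hz hlx] at this

theorem vectorMatroid_indep {I : Set (Fin N)} :
    (vectorMatroid K X).Indep I ↔ LinearIndepOn K X I := by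
  simp [vectorMatroid]

theorem mem_closure_vectorMatroid {Y : Set (Fin N)} {i : Fin N} :
    i ∈ (vectorMatroid K X).closure Y ↔ X i ∈ span K (X '' Y) := by
  have hE : (vectorMatroid K X).E = Set.univ := rfl
  have hindep {I : Set (Fin N)} (hI : (vectorMatroid K X).Indep I) (i : Fin N) :
      i ∈ (vectorMatroid K X).closure I ↔ X i ∈ span K (X '' I) := by
    rw [hI.mem_closure_iff', hE, vectorMatroid_indep, linearIndepOn_insert_iff]
    have := vectorMatroid_indep.1 hI
    by_cases hi : i ∈ I
    · have hmem : X i ∈ span K (X '' I) := subset_span (Set.mem_image_of_mem X hi)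
      simp [hi, hmem]
    · simp [hi, this]
  obtain ⟨I, hI⟩ := (vectorMatroid K X).exists_isBasis Y (by simp [hE])
  rw [← hI.closure_eq_closure, hindep hI.indep]
  have : span K (X '' I) = span K (X '' Y) := by
    refine le_antisymm (span_mono (Set.image_mono hI.subset)) (span_le.2 ?_)
    rintro _ ⟨j, hj, rfl⟩
    exact (hindep hI.indep j).1 (hI.subset_closure hj)
  rw [this]

theorem clos_eq_of_span_eq {Y Z : Set (Fin N)} (h : span K (X '' Y) = span K (X '' Z)) :
    clos K X Y = clos K X Z := by
  refine Subtype.ext (Set.ext fun i => ?_)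
  change i ∈ (vectorMatroid K X).closure Y ↔ i ∈ (vectorMatroid K X).closure Z
  rw [mem_closure_vectorMatroid, mem_closure_vectorMatroid, h]

/-- A non-passive element lies in `I` or is spanned by part of it. -/
theorem span_compl_passive (I : Finset (Fin N)) :
    span K (X '' (Set.univ \ (passive K X univ I : Set (Fin N)))) =
      span K (X '' (I : Set (Fin N))) := by
  refine le_antisymm (span_le.2 ?_) (span_mono (Set.image_mono ?_))
  · rintro _ ⟨i, hi, rfl⟩
    by_cases hiI : i ∈ I
    · exact subset_span ⟨i, hiI, rfl⟩
    · have : X i ∈ span K (X '' {j | j ∈ I ∧ i < j}) := by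
        by_contra hcon
        exact hi.2 (mem_coe.2 (mem_passive.2 ⟨mem_univ _, hiI, hcon⟩))
      exact mem_span_image_mono this fun j hj => hj.1
  · exact fun i hi => ⟨trivial, fun h => (mem_passive.1 h).2.1 hi⟩

theorem P0_eq_span_passiveProd (J : Set (Flats K X)) :
    P0 X J = span K (passiveProd K X univ '' {I : Finset (Fin N) |
      LinearIndepOn K X (I : Set (Fin N)) ∧ clos K X (I : Set (Fin N)) ∈ J}) := by
  refine le_antisymm (span_le.2 ?_) (span_mono ?_)
  · rintro _ ⟨Y, hY, rfl⟩
    have h := p_compl_mem_span_passiveProd (K := K) (X := X) Yᶜ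
    rw [compl_compl] at h
    refine span_mono (Set.image_mono ?_) h
    rintro I ⟨hI, hspan⟩
    refine ⟨hI, ?_⟩
    rwa [clos_eq_of_span_eq hspan, coe_compl, Set.compl_eq_univ_sdiff]
  · rintro _ ⟨I, ⟨-, hI⟩, rfl⟩
    refine ⟨passive K X univ I, ?_, rfl⟩
    rwa [clos_eq_of_span_eq (span_compl_passive I)]

theorem finrank_P0 (J : Set (Flats K X)) :
    Module.finrank K (P0 X J) =
      {Y : Set (Fin N) | (vectorMatroid K X).Indep Y ∧ clos K X Y ∈ J}.ncard := by
  classical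
  set A := {I : Finset (Fin N) |
    LinearIndepOn K X (I : Set (Fin N)) ∧ clos K X (I : Set (Fin N)) ∈ J} with hA
  have hli : LinearIndepOn K (passiveProd K X univ) A :=
    (linearIndepOn_passiveProd X).mono fun I hI => hI.1
  have himage : {Y : Set (Fin N) | (vectorMatroid K X).Indep Y ∧ clos K X Y ∈ J} =
      (fun I : Finset (Fin N) => (I : Set (Fin N))) '' A := by
    ext Y
    simp only [vectorMatroid_indep, Set.mem_ofPred_eq, Set.mem_image, hA]
    constructor
    · exact fun h => ⟨Y.toFinset, by simpa using h, by simp⟩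
    · rintro ⟨I, hI, rfl⟩
      exact hI
  rw [himage, Set.ncard_image_of_injective _ coe_injective, P0_eq_span_passiveProd,
    Set.image_eq_range, finrank_span_eq_card (b := fun I : A => passiveProd K X univ I.1) hli,
    ← Nat.card_eq_fintype_card, Nat.card_coe_set_eq]

end Main

end Zonotopal

theorem mainTheorem10 {K V : Type*} [Field K] [CharZero K] [AddCommGroup V] [Module K V]
    [FiniteDimensional K V] (hr : 1 ≤ Module.finrank K V)
    {N : ℕ} (X : Fin N → Module.Dual K V) (hX : Submodule.span K (Set.range X) = ⊤)
    (J : Set (Zonotopal.Flats K X)) (hJne : J.Nonempty) (hJ : IsUpperSet J) :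
    Module.finrank K (Zonotopal.P0 X J) =
      {Y : Set (Fin N) | (Zonotopal.vectorMatroid K X).Indep Y ∧ Zonotopal.clos K X Y ∈ J}.ncard :=
  Zonotopal.finrank_P0 J
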